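/- Let $M/k$ be a finite extension of number fields, let $n=[M:k]$, and let $\alpha_0,\dots,\alpha_{n-1}$ be any basis of $M$ over $k$. A number field is a CM field if it is a totally imaginary quadratic extension of a totally real field. We say that $M$ contains a CM subfield over $k$ if there is a CM field $L$, with maximal real subfield $L'$, such that $k\subseteq L'\subseteq L\subseteq M$. A subset $R\subseteq M^*$ is called a dense subset of $M$ over $k$ if the set $$\Bigl\{(x_0:\dots:x_{n-1})\in\mathbb{P}^{n-1}(k)\ :\ \sum_{j=0}^{n-1}x_j\alpha_j\in R\ \text{for some choice of the homogeneous coordinates } x_0,\dots,x_{n-1}\Bigr\}$$ is Zariski-dense in $\mathbb{P}^{n-1}$ (this does not depend on the basis). Then the group $\mathcal{O}_M^*$ of units of the ring of integers of $M$ is a dense subset of $M$ over $k$ if and only if $M$ does not contain a CM subfield over $k$. -/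

import Mathlib

open scoped NumberField LinearAlgebra.Projectivization

noncomputable section

/-- The standard grading of `K[x_0, …, x_{n-1}]` by degree. -/
abbrev stdGrading (K : Type*) [Field K] (n : ℕ) : ℕ → Submodule K (MvPolynomial (Fin n) K) :=
  MvPolynomial.homogeneousSubmodule (Fin n) K

instance stdGradedAlgebra (K : Type*) [Field K] (n : ℕ) : GradedAlgebra (stdGrading K n) :=
  MvPolynomial.gradedAlgebra

/-- The underlying space of the projective space `ℙ^{n-1}` over `K`, that is, of
`Proj K[x_0, …, x_{n-1}]`; it carries the Zariski topology. -/
abbrev ProjSpace (K : Type*) [Field K] (n : ℕ) : Type _ :=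
  ProjectiveSpectrum (stdGrading K n)

/-- The point of `Proj K[x_0, …, x_{n-1}]` defined by the `K`-rational point `p` of projective
space: the homogeneous prime ideal generated by the homogeneous polynomials which vanish at `p`
(this does not depend on the representative, see `mem_ratPoint_iff`). -/
def ratPoint {K : Type*} [Field K] {n : ℕ} (p : ℙ K (Fin n → K)) : ProjSpace K n where
  asHomogeneousIdeal :=
    (RingHom.ker (MvPolynomial.eval p.rep)).homogeneousCore (stdGrading K n)
  isPrime := (RingHom.ker_isPrime (MvPolynomial.eval p.rep)).homogeneousCore
  not_irrelevant_le := by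
    intro h
    obtain ⟨i, hi⟩ := Function.ne_iff.mp p.rep_nonzero
    have hX : (MvPolynomial.X i : MvPolynomial (Fin n) K) ∈
        HomogeneousIdeal.irrelevant (stdGrading K n) := by
      rw [HomogeneousIdeal.mem_irrelevant_iff, GradedRing.proj_apply,
        DirectSum.decompose_of_mem_ne (stdGrading K n) (i := 1) (j := 0)
          (MvPolynomial.isHomogeneous_X K i) one_ne_zero]
    have h2 := Ideal.toIdeal_homogeneousCore_le (stdGrading K n) _ (h hX)
    rw [RingHom.mem_ker, MvPolynomial.eval_X] at h2
    exact hi h2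

/-- A homogeneous polynomial lies in the prime ideal of the rational point `[v]` if and only if
it vanishes at `v`. -/
theorem mem_ratPoint_iff {K : Type*} [Field K] {n d : ℕ} (v : Fin n → K) (hv : v ≠ 0)
    (F : MvPolynomial (Fin n) K) (hF : F.IsHomogeneous d) :
    F ∈ (ratPoint (Projectivization.mk K v hv)).asHomogeneousIdeal ↔
      MvPolynomial.eval v F = 0 := by
  obtain ⟨a, ha⟩ := Projectivization.exists_smul_eq_mk_rep K v hv
  have key : MvPolynomial.eval (Projectivization.mk K v hv).rep F
      = (a : K) ^ d * MvPolynomial.eval v F := by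
    rw [← ha, MvPolynomial.eval_eq, MvPolynomial.eval_eq, Finset.mul_sum]
    refine Finset.sum_congr rfl fun m hm => ?_
    have hd : ∑ i ∈ m.support, m i = d := by
      have := hF (MvPolynomial.mem_support_iff.mp hm)
      rwa [Finsupp.weight_apply, Finsupp.sum, Finset.sum_congr rfl
        (fun i _ => by simp : ∀ i ∈ m.support, m i • (1 : Fin n → ℕ) i = m i)] at this
    simp only [Pi.smul_apply, Units.smul_def, smul_eq_mul, mul_pow, Finset.prod_mul_distrib,
      Finset.prod_pow_eq_pow_sum, hd]
    ring
  constructor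
  · intro h
    have h2 := Ideal.toIdeal_homogeneousCore_le (stdGrading K n) _ h
    rw [RingHom.mem_ker, key] at h2
    exact (mul_eq_zero.mp h2).resolve_left (pow_ne_zero _ a.ne_zero)
  · intro h
    exact Ideal.mem_homogeneousCore_of_homogeneous_of_mem ⟨d, hF⟩
      (by rw [RingHom.mem_ker, key, h, mul_zero])

/-- Let `α_0, …, α_{n-1}` be a basis of `M` over `k`. For `R ⊆ M^*`, this is the set of points
`(x_0 : … : x_{n-1})` of `ℙ^{n-1}(k)` with homogeneous coordinates such that
`x_0 α_0 + ⋯ + x_{n-1} α_{n-1}` is in `R`. -/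
def assocPoints {k M : Type*} [Field k] [Field M] [Algebra k M] {n : ℕ}
    (α : Module.Basis (Fin n) k M) (R : Set Mˣ) : Set (ℙ k (Fin n → k)) :=
  {p | ∃ (x : Fin n → k) (hx : x ≠ 0), p = Projectivization.mk k x hx ∧
    ∃ r ∈ R, (r : M) = ∑ j, x j • α j}

/-- `R ⊆ M^*` is a dense subset of `M` over `k` (with respect to the basis `α`): the associated
set of rational points is Zariski-dense in `ℙ^{n-1}`. -/
def IsDenseOver {k M : Type*} [Field k] [Field M] [Algebra k M] {n : ℕ}
    (α : Module.Basis (Fin n) k M) (R : Set Mˣ) : Prop :=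
  Dense (ratPoint '' assocPoints α R : Set (ProjSpace k n))

/-- The group of units `𝓞_M^*` as a subset of `M^*`. -/
def integerUnits (M : Type*) [Field M] : Set Mˣ :=
  Set.range (Units.map (algebraMap (𝓞 M) M : 𝓞 M →* M))

/-- `M` contains a CM subfield over `k`: there is a CM field `L` with `k ⊆ L' ⊆ L ⊆ M`, where
`L'` is the maximal real subfield of `L`. -/
def ContainsCMSubfieldOver (k M : Type*) [Field k] [Field M] [CharZero M] [Algebra k M] : Prop :=
  ∃ L : IntermediateField k M, NumberField.IsCMField L ∧
    ∀ x : k, algebraMap k L x ∈ NumberField.maximalRealSubfield L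

end

/-! Density means that no nonzero form vanishes on the units. Over a field `N` with `n` embeddings
of `M` over `k`, the conjugates `σ x` are linear coordinates, and the units become a group of points
in a torus. By independence of characters, a form vanishing there makes two of its monomials agree
on the group, so density fails exactly when some nonzero `a` with sum zero satisfies `∏ σ(u)^a σ =
1` for all units (`isDenseOver_range_iff`).

A CM subfield `L` gives such a relation: `v` and its complex conjugate differ by a root of unity for
every unit `v` of `L`, in particular for norms from `M`.

Conversely, Dirichlet's unit theorem makes `a` odd under every complex conjugation of a Galois
number field `N` (`exponent_isConj_comp`), hence invariant under products of two of them. If `a σ ≠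
0`, the elements of `M` on whose `σ`-images all conjugations agree form a field. Conjugation acts on
it, and not trivially, since otherwise oddness and invariance would give `a σ = -a σ`. So it is CM,
and its real part contains `k` because `a` lives on embeddings over `k`
(`containsCMSubfieldOver_of_odd`). -/

/-! ### Density in terms of forms -/

theorem isDenseOver_iff_forall_isHomogeneous {k M : Type*} [Field k] [Infinite k] [Field M]
    [Algebra k M] {n : ℕ} (α : Module.Basis (Fin n) k M) (R : Set Mˣ) :
    IsDenseOver α R ↔ ∀ (d : ℕ) (F : MvPolynomial (Fin n) k), F.IsHomogeneous d → F ≠ 0 →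
      ∃ r ∈ R, MvPolynomial.eval (α.repr (r : M)) F ≠ 0 := by
  have hn : 0 < n := by
    rcases Nat.eq_zero_or_pos n with rfl | h
    · have := α.repr.toEquiv.subsingleton
      exact absurd (Subsingleton.elim (1 : M) 0) one_ne_zero
    · exact h
  unfold IsDenseOver
  rw [(ProjectiveSpectrum.isTopologicalBasis_basic_opens (stdGrading k n)).dense_iff]
  constructor
  · intro h d F hF hF0
    -- The factor `X 0` forces the point of nonvanishing to be nonzero, even when `F` is constant.
    have hXF : MvPolynomial.X ⟨0, hn⟩ * F ≠ 0 := mul_ne_zero (MvPolynomial.X_ne_zero _) hF0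
    obtain ⟨v, hv⟩ : ∃ v, MvPolynomial.eval v (MvPolynomial.X ⟨0, hn⟩ * F) ≠ 0 := by
      by_contra! hc
      exact hXF (MvPolynomial.funext fun x => by simpa using hc x)
    rw [map_mul, MvPolynomial.eval_X] at hv
    have hv0 : v ≠ 0 := fun h0 => hv (by simp [h0])
    obtain ⟨q, hq1, p, ⟨x, hx, rfl, r, hr, hrx⟩, rfl⟩ := h _ ⟨F, rfl⟩ ⟨_, by
      rw [ProjectiveSpectrum.mem_coe_basicOpen, mem_ratPoint_iff v hv0 F hF]
      exact right_ne_zero_of_mul hv⟩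
    refine ⟨r, hr, ?_⟩
    rw [ProjectiveSpectrum.mem_coe_basicOpen, mem_ratPoint_iff x hx F hF] at hq1
    rwa [hrx, α.repr_sum_self]
  · rintro h _ ⟨f, rfl⟩ ⟨p, hp⟩
    have hU := ProjectiveSpectrum.basicOpen_eq_union_of_projection (stdGrading k n) f
    rw [SetLike.mem_coe, hU, TopologicalSpace.Opens.mem_iSup] at hp
    obtain ⟨i, hi⟩ := hp
    set F := GradedRing.proj (stdGrading k n) i f with hFdef
    have hFh : F.IsHomogeneous i := SetLike.coe_mem (DirectSum.decompose (stdGrading k n) f i)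
    have hF0 : F ≠ 0 := by
      intro h0
      rw [ProjectiveSpectrum.mem_basicOpen, h0] at hi
      exact hi (zero_mem p.asHomogeneousIdeal.toIdeal)
    obtain ⟨r, hr, hrF⟩ := h i F hFh hF0
    have hx : (α.repr (r : M) : Fin n → k) ≠ 0 := by
      intro h0
      have : α.repr (r : M) = 0 := DFunLike.coe_injective h0
      exact r.ne_zero (by simpa using this)
    refine ⟨ratPoint (Projectivization.mk k _ hx), ?_, _, ⟨_, hx, rfl, r, hr, (α.sum_repr _).symm⟩,
      rfl⟩
    rw [SetLike.mem_coe, hU, TopologicalSpace.Opens.mem_iSup]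
    refine ⟨i, ?_⟩
    rw [ProjectiveSpectrum.mem_basicOpen, mem_ratPoint_iff _ hx _ hFh]
    exact hrF

/-! ### Forms and multiplicative relations -/

/-- A nonzero homogeneous polynomial vanishing on the values of finitely many characters forces a
multiplicative relation of total exponent zero between them. -/
theorem MvPolynomial.IsHomogeneous.exists_multiplicative_relation {ι N H : Type*} [Fintype ι]
    [Field N] [Group H] (χ : ι → H →* N) {d : ℕ} {P : MvPolynomial ι N}
    (hP : P.IsHomogeneous d) (hP0 : P ≠ 0)
    (hvan : ∀ h, MvPolynomial.eval (fun i => χ i h) P = 0) :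
    ∃ a : ι → ℤ, a ≠ 0 ∧ ∑ i, a i = 0 ∧ ∀ h, ∏ i, χ i h ^ a i = 1 := by
  classical
  let ψ : (ι →₀ ℕ) → H →* N := fun m => ∏ i, χ i ^ m i
  have hψ : ∀ m h, ψ m h = ∏ i, χ i h ^ m i := fun m h => by simp [ψ, MonoidHom.finsetProd_apply]
  by_cases hinj : Set.InjOn ψ (P.support : Set (ι →₀ ℕ))
  · exfalso
    -- If the monomials of `P` induced distinct characters of `H`, their independence would kill all
    -- coefficients.
    have hli := (linearIndependent_monoidHom H N).comp
      (fun m : P.support => ψ m.1) (fun m m' h => Subtype.ext (hinj m.2 m'.2 h))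
    rw [Fintype.linearIndependent_iff] at hli
    have hz := hli (fun m => P.coeff m.1) (by
      funext h
      have := hvan h
      rw [MvPolynomial.eval_eq', ← Finset.sum_coe_sort] at this
      simpa [Finset.sum_apply, hψ] using this)
    obtain ⟨m, hm⟩ := MvPolynomial.support_nonempty.mpr hP0
    exact MvPolynomial.mem_support_iff.mp hm (hz ⟨m, hm⟩)
  · obtain ⟨m, hm, m', hm', hmm, hne⟩ : ∃ m ∈ P.support, ∃ m' ∈ P.support, ψ m = ψ m' ∧ m ≠ m' := by
      simpa [Set.InjOn] using hinj
    have hdeg : ∀ m ∈ P.support, ∑ i, m i = d := fun m hm => by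
      rw [hP.degree_eq_sum_deg_support hm]
      exact (Finset.sum_subset (Finset.subset_univ _) (by simp)).symm
    refine ⟨fun i => (m i : ℤ) - m' i, ?_, ?_, ?_⟩
    · intro h0
      exact hne (Finsupp.ext fun i => by have := congrFun h0 i; simp at this; omega)
    · rw [Finset.sum_sub_distrib, ← Nat.cast_sum, ← Nat.cast_sum, hdeg m hm, hdeg m' hm', sub_self]
    · intro h
      have hχ : ∀ i, χ i h ≠ 0 := fun i => ((Group.isUnit h).map (χ i)).ne_zero
      have := DFunLike.congr_fun hmm h
      rw [hψ, hψ] at this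
      simp_rw [zpow_sub₀ (hχ _), zpow_natCast, Finset.prod_div_distrib]
      rw [this, div_self]
      exact Finset.prod_ne_zero_iff.mpr fun i _ => pow_ne_zero _ (hχ i)

/-- A multiplicative relation of total exponent zero between the coordinates is a homogeneous
polynomial relation. -/
theorem exists_isHomogeneous_of_multiplicative_relation {ι N : Type*} [Fintype ι] [Field N]
    {a : ι → ℤ} (ha : a ≠ 0) (hsum : ∑ i, a i = 0) :
    ∃ (d : ℕ) (P : MvPolynomial ι N), P.IsHomogeneous d ∧ P ≠ 0 ∧
      ∀ x : ι → N, (∀ i, x i ≠ 0) → ∏ i, x i ^ a i = 1 → MvPolynomial.eval x P = 0 := by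
  classical
  -- The positive and negative parts of `a` have equal degree because `a` sums to zero; the form is
  -- the difference of their monomials.
  let m : ι →₀ ℕ := Finsupp.equivFunOnFinite.symm fun i => (a i).toNat
  let m' : ι →₀ ℕ := Finsupp.equivFunOnFinite.symm fun i => (-a i).toNat
  have hm : ∀ i, m i = (a i).toNat := fun i => rfl
  have hm' : ∀ i, m' i = (-a i).toNat := fun i => rfl
  have hdeg : m.degree = m'.degree := by
    rw [Finsupp.degree_eq_sum, Finsupp.degree_eq_sum]
    zify
    rw [← sub_eq_zero, ← Finset.sum_sub_distrib, ← hsum]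
    exact Finset.sum_congr rfl fun i _ => by rw [hm, hm']; omega
  have hmm : m' ≠ m := fun h => ha (funext fun i => by
    have := DFunLike.congr_fun h i
    rw [hm, hm'] at this
    simp only [Pi.zero_apply]
    omega)
  refine ⟨m'.degree, MvPolynomial.monomial m 1 - MvPolynomial.monomial m' 1,
    (MvPolynomial.isHomogeneous_monomial 1 hdeg).sub (MvPolynomial.isHomogeneous_monomial 1 rfl),
    fun h => ?_, fun x hx hrel => ?_⟩
  · have := congrArg (MvPolynomial.coeff m) h
    simp [MvPolynomial.coeff_monomial, hmm] at this
  · have h2 : ∀ i, x i ^ a i = x i ^ m i / x i ^ m' i := fun i => by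
      rw [← zpow_natCast, ← zpow_natCast, ← zpow_sub₀ (hx i), hm, hm']
      congr 1
      omega
    simp_rw [h2, Finset.prod_div_distrib] at hrel
    have := eq_of_div_eq_one hrel
    simpa [MvPolynomial.eval_monomial, Finsupp.prod_fintype, sub_eq_zero] using this

/-- A homogeneous polynomial over an extension which vanishes on a set of rational points can be
replaced by one over the base field. -/
theorem MvPolynomial.IsHomogeneous.exists_descent {ι k N : Type*} [Field k] [Field N] [Algebra k N]
    {d : ℕ} {P : MvPolynomial ι N} (hP : P.IsHomogeneous d) (hP0 : P ≠ 0) :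
    ∃ F : MvPolynomial ι k, F.IsHomogeneous d ∧ F ≠ 0 ∧
      ∀ x : ι → k, MvPolynomial.eval (fun i => algebraMap k N (x i)) P = 0 →
        MvPolynomial.eval x F = 0 := by
  classical
  obtain ⟨m₀, hm₀⟩ := MvPolynomial.support_nonempty.mpr hP0
  -- Applying a `k`-linear functional to the coefficients commutes with evaluation at `k`-points;
  -- `l` is chosen to keep one coefficient alive.
  obtain ⟨l, hl⟩ : ∃ l : Module.Dual k N, l (P.coeff m₀) ≠ 0 := by
    by_contra! h
    exact MvPolynomial.mem_support_iff.mp hm₀ ((Module.forall_dual_apply_eq_zero_iff k _).mp h)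
  refine ⟨∑ m ∈ P.support, MvPolynomial.monomial m (l (P.coeff m)), ?_, ?_, ?_⟩
  · exact MvPolynomial.IsHomogeneous.sum _ _ _ fun m hm =>
      MvPolynomial.isHomogeneous_monomial _ (hP.degree_eq_sum_deg_support hm).symm
  · intro h
    have := congrArg (MvPolynomial.coeff m₀) h
    rw [MvPolynomial.coeff_sum] at this
    simp only [MvPolynomial.coeff_monomial, Finset.sum_ite_eq', MvPolynomial.coeff_zero] at this
    rw [if_pos hm₀] at this
    exact hl this
  · intro x hx
    have := congrArg l hx
    rw [MvPolynomial.eval_eq, map_sum, map_zero] at this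
    rw [map_sum, ← this]
    refine Finset.sum_congr rfl fun m _ => ?_
    rw [MvPolynomial.eval_monomial, Finsupp.prod]
    simp_rw [← map_pow, ← map_prod]
    rw [mul_comm (P.coeff m), ← Algebra.smul_def, map_smul, smul_eq_mul, mul_comm]

/-- The linear substitution of variables given by a matrix. -/
theorem MvPolynomial.IsHomogeneous.exists_linear_substitution {ι κ N : Type*} [Fintype ι]
    [Field N] [Infinite N] {d : ℕ} {P : MvPolynomial κ N} (hP : P.IsHomogeneous d)
    (hP0 : P ≠ 0) (B : Matrix κ ι N) (hB : Function.Surjective B.mulVec) :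
    ∃ Q : MvPolynomial ι N, Q.IsHomogeneous d ∧ Q ≠ 0 ∧
      ∀ x, MvPolynomial.eval x Q = MvPolynomial.eval (B.mulVec x) P := by
  let Q : MvPolynomial ι N := MvPolynomial.aeval
    (fun j => ∑ i, MvPolynomial.C (B j i) * MvPolynomial.X i : κ → MvPolynomial ι N) P
  have hQ : ∀ x, MvPolynomial.eval x Q = MvPolynomial.eval (B.mulVec x) P := fun x => by
    have : (MvPolynomial.aeval x : MvPolynomial ι N →ₐ[N] N).comp (MvPolynomial.aeval
        (fun j => ∑ i, MvPolynomial.C (B j i) * MvPolynomial.X i : κ → MvPolynomial ι N)) =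
        MvPolynomial.aeval (B.mulVec x) := by
      ext j
      simp [Matrix.mulVec, dotProduct]
    exact DFunLike.congr_fun this P
  refine ⟨Q, ?_, fun h0 => hP0 (MvPolynomial.funext fun y => ?_), hQ⟩
  · have := hP.aeval (n := 1) (fun j => ∑ i, MvPolynomial.C (B j i) * MvPolynomial.X i :
      κ → MvPolynomial ι N) (fun j => MvPolynomial.IsHomogeneous.sum _ _ _ fun i _ =>
        MvPolynomial.isHomogeneous_C_mul_X _ _)
    rw [one_mul] at this
    exact this
  · obtain ⟨x, rfl⟩ := hB y
    rw [← hQ, h0, map_zero, map_zero]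

/-- If a finite extension has enough embeddings into `N`, then the matrix of embeddings of a basis
is invertible. -/
theorem exists_inverse_embeddings_matrix {k M N : Type*} [Field k] [Field M] [Field N]
    [Algebra k M] [Algebra k N] {n : ℕ} (α : Module.Basis (Fin n) k M)
    [Fintype (M →ₐ[k] N)] [DecidableEq (M →ₐ[k] N)] (hcard : Fintype.card (M →ₐ[k] N) = n) :
    ∃ B : Matrix (Fin n) (M →ₐ[k] N) N,
      Matrix.of (fun (σ : M →ₐ[k] N) j => σ (α j)) * B = 1 ∧
      B * Matrix.of (fun (σ : M →ₐ[k] N) j => σ (α j)) = 1 := by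
  let e : (M →ₐ[k] N) ≃ Fin n := Fintype.equivFinOfCardEq hcard
  let A : Matrix (M →ₐ[k] N) (Fin n) N := Matrix.of fun σ j => σ (α j)
  have hA : IsUnit (A.submatrix id e) := by
    rw [← Matrix.linearIndependent_rows_iff_isUnit, Fintype.linearIndependent_iff]
    intro c hc
    refine Fintype.linearIndependent_iff.mp (linearIndependent_toLinearMap k M N) c ?_
    refine α.ext fun j => ?_
    have := congrFun hc (e.symm j)
    simpa [A, Matrix.row] using this
  obtain ⟨⟨A', B', h1, h2⟩, rfl : A' = _⟩ := hA
  refine ⟨B'.submatrix e.symm id, ?_, ?_⟩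
  · have : A * B'.submatrix e.symm id = A.submatrix id e * B' := by
      rw [← Matrix.submatrix_id_id (A.submatrix id e * B'),
        Matrix.submatrix_mul _ _ id e.symm id e.symm.bijective]
      simp
    exact this.trans h1
  · have : B'.submatrix e.symm id * A = (B' * A.submatrix id e).submatrix e.symm e.symm := by
      rw [Matrix.submatrix_mul _ _ e.symm id e.symm Function.bijective_id]
      simp
    rw [show B'.submatrix e.symm id * Matrix.of (fun (σ : M →ₐ[k] N) j => σ (α j)) = _ from this, h2]
    simp

/-- The image of a homomorphism of groups is dense if and only if there is no multiplicative
relation of total exponent zero between the conjugates of its elements. -/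
theorem isDenseOver_range_iff {k M N H : Type*} [Field k] [CharZero k] [Field M] [Field N]
    [Algebra k M] [Algebra k N] [Group H] {n : ℕ} (α : Module.Basis (Fin n) k M)
    [Fintype (M →ₐ[k] N)] (hcard : Fintype.card (M →ₐ[k] N) = n) (f : H →* Mˣ) :
    IsDenseOver α (Set.range f) ↔ ∀ a : (M →ₐ[k] N) → ℤ, ∑ σ, a σ = 0 →
      (∀ h, ∏ σ, σ (f h : M) ^ a σ = 1) → a = 0 := by
  classical
  have : CharZero N := charZero_of_injective_algebraMap (algebraMap k N).injective
  obtain ⟨B, hAB, hBA⟩ := exists_inverse_embeddings_matrix (N := N) α hcard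
  set A : Matrix (M →ₐ[k] N) (Fin n) N := Matrix.of fun σ j => σ (α j)
  have hA : ∀ x : M, A.mulVec (fun j => algebraMap k N (α.repr x j)) = fun σ => σ x := fun x => by
    funext σ
    conv_rhs => rw [← α.sum_repr x]
    simp [A, Matrix.mulVec, dotProduct, Algebra.smul_def, mul_comm]
  have hB : ∀ x : M, B.mulVec (fun σ => σ x) = fun j => algebraMap k N (α.repr x j) := fun x => by
    rw [← hA, Matrix.mulVec_mulVec, hBA, Matrix.one_mulVec]
  rw [isDenseOver_iff_forall_isHomogeneous]
  constructor
  · intro h a hsum hrel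
    by_contra ha
    obtain ⟨d, P, hP, hP0, hPv⟩ :=
      exists_isHomogeneous_of_multiplicative_relation (N := N) ha hsum
    obtain ⟨Q, hQ, hQ0, hQe⟩ := hP.exists_linear_substitution hP0 A
      fun y => ⟨B.mulVec y, by rw [Matrix.mulVec_mulVec, hAB, Matrix.one_mulVec]⟩
    obtain ⟨F, hF, hF0, hFe⟩ := hQ.exists_descent (k := k) hQ0
    obtain ⟨_, ⟨g, rfl⟩, hg⟩ := h d F hF hF0
    refine hg (hFe _ ?_)
    rw [hQe, hA]
    exact hPv _ (fun σ => (map_ne_zero σ).mpr (f g).ne_zero) (hrel g)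
  · intro h d F hF hF0
    by_contra! hv
    have hF0' : MvPolynomial.map (algebraMap k N) F ≠ 0 := fun h0 =>
      hF0 (MvPolynomial.map_injective _ (algebraMap k N).injective (by rw [h0, map_zero]))
    obtain ⟨Q, hQ, hQ0, hQe⟩ := (hF.map (algebraMap k N)).exists_linear_substitution hF0' B
      fun y => ⟨A.mulVec y, by rw [Matrix.mulVec_mulVec, hBA, Matrix.one_mulVec]⟩
    obtain ⟨a, ha, hsum, hrel⟩ := hQ.exists_multiplicative_relation
      (fun σ : M →ₐ[k] N => (σ : M →* N).comp ((Units.coeHom M).comp f)) hQ0 (fun g => by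
        rw [hQe]
        have := hv _ ⟨g, rfl⟩
        change MvPolynomial.eval (B.mulVec fun σ => σ (f g : M)) _ = 0
        rw [hB, MvPolynomial.eval_map, ← Function.comp_def (algebraMap k N),
          ← MvPolynomial.eval₂_comp, this, map_zero])
    exact ha (h a hsum hrel)

/-! ### From a CM subfield to a relation -/

theorem filter_restrict_eq_map {k L M N : Type*} [Field k] [Field L] [Field M] [Field N]
    [Algebra k L] [Algebra k M] [Algebra L M] [IsScalarTower k L M] [Algebra k N] [Algebra L N]
    [IsScalarTower k L N] [Fintype (M →ₐ[k] N)] [Fintype (M →ₐ[L] N)]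
    [DecidableEq (L →ₐ[k] N)] (τ : L →ₐ[k] N) (hτ : ∀ x, τ x = algebraMap L N x) :
    (Finset.univ.filter fun σ : M →ₐ[k] N => σ.comp (IsScalarTower.toAlgHom k L M) = τ) =
    Finset.univ.map ⟨(AlgHom.restrictScalars k : (M →ₐ[L] N) → M →ₐ[k] N),
      AlgHom.restrictScalars_injective k⟩ := by
  ext σ
  simp only [Finset.mem_filter, Finset.mem_univ, true_and, Finset.mem_map,
    Function.Embedding.coeFn_mk]
  constructor
  · intro h
    exact ⟨{ σ with commutes' := fun r => (DFunLike.congr_fun h r).trans (hτ r) }, rfl⟩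
  · rintro ⟨σ, rfl⟩
    ext x
    exact (σ.commutes x).trans (hτ x).symm

theorem prod_fiber_eq_norm {k L M N : Type*} [Field k] [CharZero k] [Field L] [Field M] [Field N]
    [IsAlgClosed N] [Algebra k L] [Algebra k M] [Algebra L M] [IsScalarTower k L M]
    [FiniteDimensional k M] [Algebra k N] [DecidableEq (L →ₐ[k] N)] (τ : L →ₐ[k] N) (x : M) :
    ∏ σ : M →ₐ[k] N with σ.comp (IsScalarTower.toAlgHom k L M) = τ, σ x =
      τ (Algebra.norm L x) := by
  -- With `N` an `L`-algebra through `τ`, the fibre over `τ` is the set of `L`-embeddings, whose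
  -- product is the norm.
  let : Algebra L N := τ.toRingHom.toAlgebra
  have : IsScalarTower k L N := IsScalarTower.of_algebraMap_eq fun x => (τ.commutes x).symm
  have : FiniteDimensional L M := FiniteDimensional.right k L M
  have : CharZero L := charZero_of_injective_algebraMap (algebraMap k L).injective
  rw [filter_restrict_eq_map τ fun _ => rfl, Finset.prod_map]
  exact (Algebra.norm_eq_prod_embeddings L N x).symm

theorem card_fiber_eq_finrank {k L M N : Type*} [Field k] [CharZero k] [Field L] [Field M]
    [Field N] [IsAlgClosed N] [Algebra k L] [Algebra k M] [Algebra L M] [IsScalarTower k L M]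
    [FiniteDimensional k M] [Algebra k N] [DecidableEq (L →ₐ[k] N)] (τ : L →ₐ[k] N) :
    (Finset.univ.filter fun σ : M →ₐ[k] N =>
      σ.comp (IsScalarTower.toAlgHom k L M) = τ).card = Module.finrank L M := by
  let : Algebra L N := τ.toRingHom.toAlgebra
  have : IsScalarTower k L N := IsScalarTower.of_algebraMap_eq fun x => (τ.commutes x).symm
  have : FiniteDimensional L M := FiniteDimensional.right k L M
  have : CharZero L := charZero_of_injective_algebraMap (algebraMap k L).injective
  rw [filter_restrict_eq_map τ fun _ => rfl, Finset.card_map, Finset.card_univ, AlgHom.card]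

/-- In a CM field, a fixed power of every unit is real. -/
theorem NumberField.IsCMField.complexConj_unit_pow_torsionOrder (L : Type*) [Field L]
    [NumberField L] [NumberField.IsCMField L] (v : (𝓞 L)ˣ) :
    NumberField.IsCMField.complexConj L (v : L) ^ NumberField.Units.torsionOrder L =
      (v : L) ^ NumberField.Units.torsionOrder L := by
  have h := congrArg (fun t : NumberField.Units.torsion L => (t : (𝓞 L)ˣ))
    (pow_card_eq_one' (x := NumberField.IsCMField.unitsMulComplexConjInv L v))
  simp only [NumberField.IsCMField.unitsMulComplexConjInv_apply, SubmonoidClass.coe_pow, mul_pow,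
    inv_pow, OneMemClass.coe_one, mul_inv_eq_one] at h
  have h2 := congrArg (fun t : (𝓞 L)ˣ => ((t : 𝓞 L) : L)) h
  simp only [Units.val_pow_eq_pow_val, map_pow] at h2
  exact h2.symm

/-- With `w` the number of roots of unity in `L`, take exponent `w` on the embeddings extending `τ`
and `-w` on those extending its conjugate `τ'`. The product is then `τ(v)^w / τ'(v)^w` for the unit
`v` that is the norm of `u`, and the fibres have equal size. -/
theorem exists_relation_of_containsCMSubfieldOver {k M N : Type*} [Field k] [NumberField k]
    [Field M] [NumberField M] [Algebra k M] [Field N] [IsAlgClosed N] [Algebra k N] [Algebra M N]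
    [IsScalarTower k M N] (h : ContainsCMSubfieldOver k M) :
    ∃ a : (M →ₐ[k] N) → ℤ, a ≠ 0 ∧ ∑ σ, a σ = 0 ∧
      ∀ u : (𝓞 M)ˣ, ∏ σ, σ ((u : 𝓞 M) : M) ^ a σ = 1 := by
  classical
  obtain ⟨L, hL, hreal⟩ := h
  have : FiniteDimensional ℚ L := FiniteDimensional.of_injective
    ((L.val : L →+* M).toRatAlgHom.toLinearMap) L.val.injective
  have : NumberField L := ⟨⟩
  have hconj : ∀ x : k, NumberField.IsCMField.complexConj L (algebraMap k L x) =
      algebraMap k L x := fun x =>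
    (NumberField.IsCMField.complexConj_eq_self_iff L _).mpr (hreal x)
  let c : L →ₐ[k] L :=
    { (NumberField.IsCMField.complexConj L : L →+* L) with commutes' := hconj }
  have hc : ∀ x, c x = NumberField.IsCMField.complexConj L x := fun _ => rfl
  let τ : L →ₐ[k] N := IsScalarTower.toAlgHom k L N
  let τ' : L →ₐ[k] N := τ.comp c
  have hτ : τ' ≠ τ := by
    intro h
    refine NumberField.IsCMField.complexConj_ne_one L (AlgEquiv.ext fun x => ?_)
    exact τ.injective (DFunLike.congr_fun h x)
  let w : ℕ := NumberField.Units.torsionOrder L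
  have hw : w ≠ 0 := NumberField.Units.torsionOrder_ne_zero L
  let r : (M →ₐ[k] N) → (L →ₐ[k] N) := fun σ => σ.comp (IsScalarTower.toAlgHom k L M)
  have hr : r (IsScalarTower.toAlgHom k M N) = τ := by
    ext x
    exact (IsScalarTower.algebraMap_apply L M N x).symm
  refine ⟨fun σ => (if r σ = τ then (w : ℤ) else 0) + if r σ = τ' then -(w : ℤ) else 0, ?_, ?_, ?_⟩
  · intro h0
    have := congrFun h0 (IsScalarTower.toAlgHom k M N)
    simp only [hr, if_true, if_neg hτ.symm, Pi.zero_apply, add_zero, Nat.cast_eq_zero] at this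
    exact hw this
  · rw [Finset.sum_add_distrib, ← Finset.sum_filter, ← Finset.sum_filter, Finset.sum_const,
      Finset.sum_const, show _ = _ from card_fiber_eq_finrank τ,
      show _ = _ from card_fiber_eq_finrank τ']
    simp
  · intro u
    have hu : ∀ σ : M →ₐ[k] N, σ ((u : 𝓞 M) : M) ≠ 0 := fun σ =>
      (map_ne_zero σ).mpr (NumberField.Units.coe_ne_zero u)
    have hterm : ∀ σ : M →ₐ[k] N, σ ((u : 𝓞 M) : M) ^
        ((if r σ = τ then (w : ℤ) else 0) + if r σ = τ' then -(w : ℤ) else 0) =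
        (if r σ = τ then σ ((u : 𝓞 M) : M) ^ w else 1) *
        (if r σ = τ' then (σ ((u : 𝓞 M) : M) ^ w)⁻¹ else 1) := fun σ => by
      rw [zpow_add₀ (hu σ)]
      split_ifs <;> simp
    simp_rw [hterm]
    rw [Finset.prod_mul_distrib, ← Finset.prod_filter, ← Finset.prod_filter, Finset.prod_inv_distrib,
      Finset.prod_pow, Finset.prod_pow, show _ = _ from prod_fiber_eq_norm τ _,
      show _ = _ from prod_fiber_eq_norm τ' _]
    let v : (𝓞 L)ˣ := Units.map (RingOfIntegers.norm L) u
    have hv : Algebra.norm L ((u : 𝓞 M) : M) = (v : L) := rfl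
    have h1 : τ' (v : L) ^ w = τ (v : L) ^ w := by
      rw [← map_pow τ', ← map_pow τ]
      exact congrArg τ ((map_pow (NumberField.IsCMField.complexConj L) _ _).trans
        (NumberField.IsCMField.complexConj_unit_pow_torsionOrder L v))
    rw [hv, h1, mul_inv_cancel₀]
    exact pow_ne_zero _ ((map_ne_zero τ).mpr (NumberField.Units.coe_ne_zero v))

/-! ### Oddness of the exponents, from Dirichlet's unit theorem -/

open NumberField NumberField.InfinitePlace NumberField.Units
  NumberField.Units.dirichletUnitTheorem in
/-- By Dirichlet's unit theorem, the product formula is the only linear relation between the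
logarithms of the absolute values of the units. -/
theorem NumberField.Units.eq_zero_of_sum_mul_log_eq_zero {K : Type*} [Field K] [NumberField K]
    (b : InfinitePlace K → ℝ) (hsum : ∑ v, b v = 0)
    (h : ∀ u : (𝓞 K)ˣ, ∑ v, b v * Real.log (v ((u : 𝓞 K) : K)) = 0) : b = 0 := by
  classical
  let c : InfinitePlace K → ℝ := fun v => b v / mult v
  have hbc : ∀ v, b v = c v * mult v := fun v => (div_mul_cancel₀ _ mult_coe_ne_zero).symm
  have hc : ∀ v, c v = c w₀ := by
    -- The log space omits `w₀`, so the product formula is used to eliminate that term; the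
    -- resulting functional vanishes on the unit lattice, which spans.
    let f : logSpace K →ₗ[ℝ] ℝ := ∑ w : {w : InfinitePlace K // w ≠ w₀},
      (c w.1 - c w₀) • LinearMap.proj w
    have hf : f = 0 := by
      refine LinearMap.ext_on (unitLattice_span_eq_top K) ?_
      rintro _ ⟨x, -, rfl⟩
      obtain ⟨u, rfl⟩ := Additive.ofMul.surjective x
      have hu := h u
      have h0 := sum_logEmbedding_component u
      rw [Fintype.sum_eq_add_sum_subtype_ne _ w₀] at hu
      have : f (logEmbedding K (Additive.ofMul u)) =
          ∑ w : {w : InfinitePlace K // w ≠ w₀}, b w.1 * Real.log (w.1 ((u : 𝓞 K) : K)) -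
          c w₀ * ∑ w, logEmbedding K (Additive.ofMul u) w := by
        simp only [f, LinearMap.coe_sum, Finset.sum_apply, LinearMap.smul_apply,
          LinearMap.proj_apply, logEmbedding_component, smul_eq_mul]
        rw [Finset.mul_sum, ← Finset.sum_sub_distrib]
        exact Finset.sum_congr rfl fun w _ => by rw [hbc w.1]; ring
      change f (logEmbedding K (Additive.ofMul u)) = 0
      rw [this, h0, ← hu, hbc w₀]
      ring
    intro v
    by_cases hv : v = w₀
    · rw [hv]
    · have := congrArg (fun g => g (Pi.single ⟨v, hv⟩ 1)) hf
      simpa [f, Pi.single_apply, sub_eq_zero] using this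
  have hz : c w₀ = 0 := by
    simp_rw [hbc, hc] at hsum
    rw [← Finset.mul_sum, ← Nat.cast_sum, sum_mult_eq] at hsum
    exact (mul_eq_zero.mp hsum).resolve_right (Nat.cast_ne_zero.mpr Module.finrank_pos.ne')
  funext v
  rw [hbc, hc, hz, zero_mul, Pi.zero_apply]

open NumberField NumberField.InfinitePlace NumberField.Units in
/-- In a multiplicative relation between the conjugates of units, the exponents of the conjugates
lying over a given infinite place sum to zero. -/
theorem sum_exponents_over_infinitePlace_eq_zero {M N : Type*} [Field M] [NumberField M] [Field N]
    [Fintype (M →+* N)] (a : (M →+* N) → ℤ) (hsum : ∑ σ, a σ = 0)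
    (hrel : ∀ u : (𝓞 M)ˣ, ∏ σ, σ ((u : 𝓞 M) : M) ^ a σ = 1) (ψ : N →+* ℂ)
    [DecidableEq (InfinitePlace M)] (v : InfinitePlace M) :
    ∑ σ with InfinitePlace.mk (ψ.comp σ) = v, a σ = 0 := by
  have hb := eq_zero_of_sum_mul_log_eq_zero (K := M)
    (fun v => ((∑ σ with InfinitePlace.mk (ψ.comp σ) = v, a σ : ℤ) : ℝ)) (by
      rw [← Int.cast_sum, Finset.sum_fiberwise, hsum, Int.cast_zero]) (fun u => by
      have h1 : ∑ σ : M →+* N, (a σ : ℝ) *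
          Real.log (InfinitePlace.mk (ψ.comp σ) ((u : 𝓞 M) : M)) = 0 := by
        have := congrArg (fun x => Real.log ‖ψ x‖) (hrel u)
        simp only [map_prod, map_zpow₀, norm_prod, norm_zpow, map_one, norm_one,
          Real.log_one] at this
        rw [Real.log_prod] at this
        · simpa [Real.log_zpow] using this
        · intro σ _
          exact zpow_ne_zero _ (norm_ne_zero_iff.mpr ((map_ne_zero ψ).mpr
            ((map_ne_zero σ).mpr (coe_ne_zero u))))
      rw [← h1, ← Finset.sum_fiberwise Finset.univ fun σ : M →+* N => InfinitePlace.mk (ψ.comp σ)]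
      refine Finset.sum_congr rfl fun v _ => ?_
      rw [Int.cast_sum, Finset.sum_mul]
      refine Finset.sum_congr rfl fun σ hσ => ?_
      rw [(Finset.mem_filter.mp hσ).2])
  exact Int.cast_eq_zero.mp (congrFun hb v)

open NumberField NumberField.InfinitePlace NumberField.ComplexEmbedding in
/-- In a multiplicative relation between the conjugates of units, complex conjugations change the
signs of the exponents. -/
theorem exponent_isConj_comp {M N : Type*} [Field M] [NumberField M] [Field N] [NumberField N]
    [Fintype (M →+* N)] (a : (M →+* N) → ℤ) (hsum : ∑ σ, a σ = 0)
    (hrel : ∀ u : (𝓞 M)ˣ, ∏ σ, σ ((u : 𝓞 M) : M) ^ a σ = 1) {ψ : N →+* ℂ} {c : Gal(N/ℚ)}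
    (hc : IsConj ψ c) (σ : M →+* N) : a ((c : N →+* N).comp σ) = -a σ := by
  classical
  have h := sum_exponents_over_infinitePlace_eq_zero a hsum hrel ψ (InfinitePlace.mk (ψ.comp σ))
  have hfil : (Finset.univ.filter fun τ : M →+* N =>
      InfinitePlace.mk (ψ.comp τ) = InfinitePlace.mk (ψ.comp σ)) =
      {σ, (c : N →+* N).comp σ} := by
    ext τ
    simp only [Finset.mem_filter, Finset.mem_univ, true_and, Finset.mem_insert,
      Finset.mem_singleton]
    rw [eq_comm, InfinitePlace.mk_eq_iff]
    refine or_congr ⟨fun h => ?_, fun h => by rw [h]⟩ ⟨fun h => ?_, fun h => ?_⟩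
    · exact RingHom.ext fun x => ψ.injective (RingHom.congr_fun h x).symm
    · refine RingHom.ext fun x => ψ.injective ((RingHom.congr_fun h x).symm.trans ?_)
      exact (hc.eq (σ x)).symm
    · rw [h]
      exact RingHom.ext fun x => (hc.eq (σ x)).symm
  rw [hfil] at h
  -- Over a real place the two embeddings coincide and the single exponent is zero.
  by_cases heq : σ = (c : N →+* N).comp σ
  · rw [← heq] at h ⊢
    simp only [Finset.pair_eq_singleton, Finset.sum_singleton] at h
    rw [h, neg_zero]
  · rw [Finset.sum_pair heq] at h
    linarith

/-! ### Complex conjugations and the CM subfield -/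

open NumberField NumberField.ComplexEmbedding in
/-- A number field with a nontrivial automorphism which is the complex conjugation for every
complex embedding is a CM field. -/
theorem NumberField.IsCMField.of_forall_isConj_of_ne_one {L : Type*} [Field L] [NumberField L]
    {j : Gal(L/ℚ)} (hj : ∀ φ : L →+* ℂ, IsConj φ j) (hj1 : j ≠ 1) : IsCMField L := by
  have hcpx : IsTotallyComplex L := ⟨fun w => by
    rw [← InfinitePlace.mk_embedding w, InfinitePlace.isComplex_mk_iff]
    exact (isConj_ne_one_iff (hj _)).mp hj1⟩
  obtain ⟨φ⟩ : Nonempty (L →+* ℂ) := inferInstance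
  have hcard : Nat.card (Subgroup.zpowers j) = 2 := by
    rw [Nat.card_zpowers, orderOf_isConj_two_of_ne_one (hj φ) hj1]
  have : Finite (Subgroup.zpowers j) := Nat.finite_of_card_ne_zero (by positivity)
  let : Fintype (Subgroup.zpowers j) := Fintype.ofFinite _
  let F : Subfield L := FixedPoints.subfield (Subgroup.zpowers j) L
  have hF : ∀ x ∈ F, j x = x := fun x hx => hx ⟨j, Subgroup.mem_zpowers j⟩
  have : IsTotallyReal F := ⟨fun w => by
    obtain ⟨W, rfl⟩ := w.comap_surjective (K := L)
    dsimp only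
    rw [← InfinitePlace.mk_embedding W, InfinitePlace.comap_mk, InfinitePlace.isReal_mk_iff]
    refine RingHom.ext fun x => ?_
    have := (hj W.embedding).eq (x : L)
    rw [hF x x.2] at this
    exact this.symm⟩
  have : Algebra.IsQuadraticExtension F L := ⟨by
    rw [FixedPoints.finrank_eq_card, ← Nat.card_eq_fintype_card, hcard]⟩
  exact IsCMField.ofCMExtension F L

open NumberField NumberField.ComplexEmbedding in
theorem NumberField.ComplexEmbedding.exists_isConj_of_isGalois {N : Type*} [Field N]
    [NumberField N] [IsGalois ℚ N] (ψ : N →+* ℂ) : ∃ c : Gal(N/ℚ), IsConj ψ c := by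
  obtain ⟨σ, hσ⟩ := exists_comp_symm_eq_of_comp_eq (k := ℚ) ψ (conjugate ψ) (by ext; simp)
  exact ⟨σ.symm, hσ.symm⟩

/-- The complex conjugations of a number field which is Galois over `ℚ`. -/
def complexConjugations (N : Type*) [Field N] [CharZero N] : Set Gal(N/ℚ) :=
  {c | ∃ ψ : N →+* ℂ, NumberField.ComplexEmbedding.IsConj ψ c}

theorem apply_apply_of_mem_complexConjugations {N : Type*} [Field N] [CharZero N] {c : Gal(N/ℚ)}
    (hc : c ∈ complexConjugations N) (x : N) : c (c x) = x := by
  obtain ⟨ψ, hψ⟩ := hc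
  exact NumberField.ComplexEmbedding.isConj_apply_apply hψ x

theorem conj_mem_complexConjugations {N : Type*} [Field N] [CharZero N] {c : Gal(N/ℚ)}
    (hc : c ∈ complexConjugations N) (g : Gal(N/ℚ)) : g * c * g⁻¹ ∈ complexConjugations N := by
  obtain ⟨ψ, hψ⟩ := hc
  exact ⟨_, by simpa using hψ.comp g⁻¹⟩

/-- The subgroup generated by the products of two complex conjugations. -/
def conjugationProducts (N : Type*) [Field N] [CharZero N] : Subgroup Gal(N/ℚ) :=
  Subgroup.closure {g | ∃ c ∈ complexConjugations N, ∃ c' ∈ complexConjugations N, c * c' = g}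

theorem conjugationProducts_normal (N : Type*) [Field N] [CharZero N] : (conjugationProducts N).Normal := by
  refine ⟨fun d hd g => ?_⟩
  induction hd using Subgroup.closure_induction with
  | mem x hx =>
    obtain ⟨c, hc, c', hc', rfl⟩ := hx
    exact Subgroup.subset_closure ⟨_, conj_mem_complexConjugations hc g, _,
      conj_mem_complexConjugations hc' g, by group⟩
  | one => simp
  | mul x y _ _ hx hy =>
    rw [show g * (x * y) * g⁻¹ = (g * x * g⁻¹) * (g * y * g⁻¹) by group]
    exact mul_mem hx hy
  | inv x _ hx =>
    rw [show g * x⁻¹ * g⁻¹ = (g * x * g⁻¹)⁻¹ by group]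
    exact inv_mem hx

/-- The elements of `M` on whose images under `σ` all complex conjugations agree, when all complex
conjugations fix the image of `k`. -/
def commonConjugationField {k M N : Type*} [Field k] [Field M] [Field N] [CharZero N] [Algebra k M]
    (σ : M →+* N)
    (hk : ∀ c ∈ complexConjugations N, ∀ x : k, c (σ (algebraMap k M x)) = σ (algebraMap k M x)) :
    IntermediateField k M where
  carrier := {x | ∀ c ∈ complexConjugations N, ∀ c' ∈ complexConjugations N, c (σ x) = c' (σ x)}
  mul_mem' hx hy c hc c' hc' := by simp only [map_mul, hx c hc c' hc', hy c hc c' hc']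
  add_mem' hx hy c hc c' hc' := by simp only [map_add, hx c hc c' hc', hy c hc c' hc']
  algebraMap_mem' x c hc c' hc' := by rw [hk c hc, hk c' hc']
  inv_mem' x hx c hc c' hc' := by simp only [map_inv₀, hx c hc c' hc']

section

variable {k M N : Type*} [Field k] [Field M] [Field N] [NumberField N] [IsGalois ℚ N] [Algebra k M]
  (σ : M →+* N)
  (hk : ∀ c ∈ complexConjugations N, ∀ x : k, c (σ (algebraMap k M x)) = σ (algebraMap k M x))

/-- If `h` fixes `σ M`, then `h c h⁻¹` is again a complex conjugation, so it agrees with `c` at `σ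
x`. Hence `h` fixes `c (σ x)`, which lies in `σ M` by Galois theory. This lets `c` act on the field.
-/
theorem exists_mem_commonConjugationField {c : Gal(N/ℚ)} (hc : c ∈ complexConjugations N)
    [CharZero M] {x : M} (hx : x ∈ commonConjugationField σ hk) :
    ∃ y ∈ commonConjugationField σ hk, σ y = c (σ x) := by
  let E : IntermediateField ℚ N := σ.toRatAlgHom.fieldRange
  have hE : c (σ x) ∈ E := by
    rw [← IsGalois.fixedField_fixingSubgroup E, IntermediateField.mem_fixedField_iff]
    intro h hh
    rw [IntermediateField.mem_fixingSubgroup_iff] at hh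
    have h1 := hx _ (conj_mem_complexConjugations hc h) c hc
    have h2 : h⁻¹ (σ x) = σ x := by
      rw [AlgEquiv.aut_inv, AlgEquiv.symm_apply_eq]
      exact (hh _ ⟨x, rfl⟩).symm
    rw [AlgEquiv.mul_apply, AlgEquiv.mul_apply, h2] at h1
    exact h1
  obtain ⟨y, hy⟩ := hE
  replace hy : σ y = c (σ x) := hy
  have key : ∀ c' ∈ complexConjugations N, c' (σ y) = σ x := fun c' hc' => by
    rw [hy, hx c hc c' hc', apply_apply_of_mem_complexConjugations hc']
  exact ⟨y, fun c' hc' c'' hc'' => by rw [key c' hc', key c'' hc''], hy⟩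

/-- An element of `σ M` fixed by all products of two conjugations comes from the common conjugation
field. By the Galois correspondence `c` lies in the join of `conjugationProducts N` with the
stabilizer of `σ M`, and normality turns the join into a product. -/
theorem exists_mul_eq_of_fixes_commonConjugationField {c : Gal(N/ℚ)} [CharZero M]
    (hfix : ∀ x ∈ commonConjugationField σ hk, c (σ x) = σ x) :
    ∃ d ∈ conjugationProducts N, ∃ h : Gal(N/ℚ), (∀ x, h (σ x) = σ x) ∧ d * h = c := by
  have := conjugationProducts_normal N
  let E : IntermediateField ℚ N := σ.toRatAlgHom.fieldRange
  have hmem : c ∈ conjugationProducts N ⊔ E.fixingSubgroup := by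
    rw [← IntermediateField.fixingSubgroup_fixedField
      (conjugationProducts N ⊔ E.fixingSubgroup), IntermediateField.mem_fixingSubgroup_iff]
    intro y hy
    rw [IntermediateField.mem_fixedField_iff] at hy
    have hyE : y ∈ E := by
      rw [← IsGalois.fixedField_fixingSubgroup E, IntermediateField.mem_fixedField_iff]
      exact fun h hh => hy h (Subgroup.mem_sup_right hh)
    obtain ⟨x, rfl⟩ := hyE
    refine hfix x fun c hc c' hc' => ?_
    have h1 := hy (c' * c) (Subgroup.mem_sup_left (Subgroup.subset_closure ⟨c', hc', c, hc, rfl⟩))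
    have h2 := congrArg c' h1
    rw [AlgEquiv.mul_apply, apply_apply_of_mem_complexConjugations hc'] at h2
    exact h2
  obtain ⟨d, hd, h, hh, rfl⟩ := Subgroup.mem_sup_of_normal_left.mp hmem
  exact ⟨d, hd, h, fun x => (IntermediateField.mem_fixingSubgroup_iff _ _).mp hh _ ⟨x, rfl⟩, rfl⟩

end

open NumberField NumberField.ComplexEmbedding in
/-- A nonzero integral function on the embeddings of `M`, which is odd for all complex conjugations
and supported on the embeddings with a given restriction to `k`, comes from a CM subfield. -/
theorem containsCMSubfieldOver_of_odd {k M N : Type*} [Field k] [Field M] [NumberField M]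
    [Algebra k M] [Field N] [NumberField N] [IsGalois ℚ N] (a : (M →+* N) → ℤ)
    (hodd : ∀ c ∈ complexConjugations N, ∀ σ : M →+* N, a ((c : N →+* N).comp σ) = -a σ)
    (hsupp : ∀ σ τ : M →+* N, a σ ≠ 0 → a τ ≠ 0 → ∀ x : k,
      σ (algebraMap k M x) = τ (algebraMap k M x))
    (ha : a ≠ 0) : ContainsCMSubfieldOver k M := by
  obtain ⟨σ, hσ⟩ := Function.ne_iff.mp ha
  rw [Pi.zero_apply] at hσ
  have hk : ∀ c ∈ complexConjugations N, ∀ x : k,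
      c (σ (algebraMap k M x)) = σ (algebraMap k M x) := fun c hc =>
    hsupp ((c : N →+* N).comp σ) σ (by rw [hodd c hc]; exact neg_ne_zero.mpr hσ) hσ
  have hinv : ∀ d ∈ conjugationProducts N, ∀ τ : M →+* N, a ((d : N →+* N).comp τ) = a τ := by
    intro d hd
    induction hd using Subgroup.closure_induction with
    | mem x hx =>
      obtain ⟨c, hc, c', hc', rfl⟩ := hx
      intro τ
      rw [← neg_neg (a τ), ← hodd c' hc', ← hodd c hc]
      rfl
    | one => exact fun τ => rfl
    | mul x y _ _ hx hy => exact fun τ => (hx ((y : N →+* N).comp τ)).trans (hy τ)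
    | inv x _ hx =>
      intro τ
      rw [← hx]
      congr 1
      ext y
      exact x.apply_symm_apply (τ y)
  let L : IntermediateField k M := commonConjugationField σ hk
  have : FiniteDimensional ℚ L := FiniteDimensional.of_injective
    ((L.val : L →+* M).toRatAlgHom.toLinearMap) L.val.injective
  have : NumberField L := ⟨⟩
  obtain ⟨ψ₀⟩ : Nonempty (N →+* ℂ) := inferInstance
  obtain ⟨c, hψc⟩ := exists_isConj_of_isGalois ψ₀
  have hc : c ∈ complexConjugations N := ⟨ψ₀, hψc⟩
  choose f hfL hf using fun x : L => exists_mem_commonConjugationField σ hk hc x.2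
  let j₀ : L →+* L :=
    { toFun := fun x => ⟨f x, hfL x⟩
      map_one' := Subtype.ext (σ.injective (by simp [hf]))
      map_mul' := fun x y => Subtype.ext (σ.injective (by simp [hf]))
      map_zero' := Subtype.ext (σ.injective (by simp [hf]))
      map_add' := fun x y => Subtype.ext (σ.injective (by simp [hf])) }
  have hj₀ : ∀ x : L, σ (j₀ x : M) = c (σ x) := hf
  have hj₀j₀ : ∀ x : L, j₀ (j₀ x) = x := fun x => Subtype.ext (σ.injective (by
    rw [hj₀, hj₀, apply_apply_of_mem_complexConjugations hc]))
  let j : Gal(L/ℚ) := AlgEquiv.ofAlgHom j₀.toRatAlgHom j₀.toRatAlgHom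
    (AlgHom.ext hj₀j₀) (AlgHom.ext hj₀j₀)
  have hj : ∀ φ : L →+* ℂ, IsConj φ j := by
    intro φ
    -- Viewing `L` inside `N` through `σ`, every `φ` extends to `N`; on `σ L` the conjugation of the
    -- extension agrees with `c`.
    let : Algebra L N := (σ.comp (L.val : L →+* M)).toAlgebra
    have : Algebra.IsAlgebraic L N := Algebra.IsAlgebraic.tower_top (K := ℚ) L
    let ψ := ComplexEmbedding.lift N φ
    have hψ : ∀ x : L, ψ (σ x) = φ x := fun x =>
      RingHom.congr_fun (ComplexEmbedding.lift_comp_algebraMap (K := N) φ) x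
    obtain ⟨c', hψc'⟩ := exists_isConj_of_isGalois ψ
    refine RingHom.ext fun x => ?_
    change star (φ x) = φ (j₀ x)
    rw [← hψ, ← hψ, hj₀, x.2 c hc c' ⟨ψ, hψc'⟩, hψc'.eq]
  have hj1 : j ≠ 1 := by
    intro h1
    have hfix : ∀ x ∈ L, c (σ x) = σ x := fun x hx => by
      rw [← hj₀ ⟨x, hx⟩]
      exact congrArg (fun y : L => σ y) (DFunLike.congr_fun h1 ⟨x, hx⟩)
    -- Writing `c = d h`, invariance under `d` gives `a (c σ) = a σ`, whereas oddness gives `-a σ`.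
    obtain ⟨d, hd, h, hh, rfl⟩ := exists_mul_eq_of_fixes_commonConjugationField σ hk hfix
    have h2 := hodd _ hc σ
    have h3 : (((d * h : Gal(N/ℚ)) : N →+* N)).comp σ = (d : N →+* N).comp σ :=
      RingHom.ext fun x => congrArg d (hh x)
    rw [h3, hinv d hd] at h2
    omega
  refine ⟨L, IsCMField.of_forall_isConj_of_ne_one hj hj1, fun x => ?_⟩
  rw [mem_maximalRealSubfield_iff]
  intro φ
  rw [← (hj φ).eq]
  congr 1
  refine Subtype.ext (σ.injective ?_)
  exact (hj₀ _).trans (hk c hc x)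

/-- Complex conjugations of `N` need not fix `k`, so `a` is first extended by zero to all ring
embeddings of `M`. -/
theorem containsCMSubfieldOver_of_relation {k M N : Type*} [Field k] [NumberField k] [Field M]
    [NumberField M] [Algebra k M] [Field N] [NumberField N] [IsGalois ℚ N] [Algebra k N]
    (a : (M →ₐ[k] N) → ℤ) (ha : a ≠ 0) (hsum : ∑ σ, a σ = 0)
    (hrel : ∀ u : (𝓞 M)ˣ, ∏ σ, σ ((u : 𝓞 M) : M) ^ a σ = 1) : ContainsCMSubfieldOver k M := by
  classical
  let e : (M →ₐ[k] N) → (M →+* N) := fun σ => σ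
  have he : Function.Injective e := AlgHom.coe_ringHom_injective
  let b : (M →+* N) → ℤ := Function.extend e a 0
  have hb : ∀ σ, b (e σ) = a σ := he.extend_apply a 0
  have hb0 : ∀ τ, τ ∉ Set.range e → b τ = 0 := fun τ hτ =>
    Function.extend_apply' a (0 : (M →+* N) → ℤ) τ hτ
  have hbsum : ∑ τ, b τ = 0 := by
    rw [← hsum]
    exact (Fintype.sum_of_injective e he a b hb0 fun σ => (hb σ).symm).symm
  have hbrel : ∀ u : (𝓞 M)ˣ, ∏ τ, τ ((u : 𝓞 M) : M) ^ b τ = 1 := fun u => by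
    rw [← hrel u]
    exact (Fintype.prod_of_injective e he _ _ (fun τ hτ => by rw [hb0 τ hτ, zpow_zero])
      fun σ => by rw [hb]; rfl).symm
  have hbr : ∀ τ, b τ ≠ 0 → ∀ x : k, τ (algebraMap k M x) = algebraMap k N x := fun τ hτ x => by
    obtain ⟨σ, rfl⟩ := not_imp_comm.mp (hb0 τ) hτ
    exact σ.commutes x
  refine containsCMSubfieldOver_of_odd (N := N) b ?_
    (fun σ τ hσ hτ x => (hbr σ hσ x).trans (hbr τ hτ x).symm)
    (fun h0 => ha (funext fun σ => by rw [← hb, h0]; rfl))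
  rintro c ⟨ψ, hψ⟩ σ
  exact exponent_isConj_comp b hbsum hbrel hψ σ

/-! ### Conclusion -/

theorem card_algHom_normalClosure {k M : Type*} [Field k] [NumberField k] [Field M] [NumberField M]
    [Algebra k M] {N : Type*} [Field N] [NumberField N] [IsGalois ℚ N] [Algebra M N] [Algebra k N]
    [IsScalarTower k M N] : Fintype.card (M →ₐ[k] N) = Module.finrank k M := by
  refine AlgHom.card_of_splits k M N fun x => ?_
  have : Normal k N := Normal.tower_top_of_normal ℚ k N
  rw [← minpoly.algebraMap_eq (algebraMap M N).injective]
  exact Normal.splits this _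

theorem theorem3p2 {k M : Type*} [Field k] [NumberField k] [Field M] [NumberField M]
    [Algebra k M] {n : ℕ} (α : Module.Basis (Fin n) k M) :
    IsDenseOver α (integerUnits M) ↔ ¬ ContainsCMSubfieldOver k M := by
  have hn : Module.finrank k M = n := by rw [Module.finrank_eq_card_basis α, Fintype.card_fin]
  constructor
  · intro hdense hCM
    obtain ⟨a, ha, hsum, hrel⟩ :=
      exists_relation_of_containsCMSubfieldOver (N := AlgebraicClosure M) hCM
    exact ha ((isDenseOver_range_iff α ((AlgHom.card k M _).trans hn) _).mp hdense a hsum hrel)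
  · intro hCM
    -- This direction needs a number field Galois over `ℚ`, not only over `k`, so that complex
    -- conjugations are automorphisms of `N`.
    let N := IntermediateField.normalClosure ℚ M (AlgebraicClosure M)
    let : Algebra k N := ((algebraMap M N).comp (algebraMap k M)).toAlgebra
    have : IsScalarTower k M N := IsScalarTower.of_algebraMap_eq fun _ => rfl
    have : FiniteDimensional ℚ N := inferInstance
    have : NumberField N := ⟨⟩
    have : Algebra.IsAlgebraic ℚ (AlgebraicClosure M) := Algebra.IsAlgebraic.trans ℚ M _
    have : IsAlgClosure ℚ (AlgebraicClosure M) := ⟨inferInstance, inferInstance⟩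
    have : Normal ℚ (AlgebraicClosure M) := IsAlgClosure.normal ℚ _
    have : Normal ℚ N := normalClosure.normal ℚ M (AlgebraicClosure M)
    have : IsGalois ℚ N := ⟨⟩
    refine (isDenseOver_range_iff (N := N) α (card_algHom_normalClosure.trans hn) _).mpr
      fun a hsum hrel => ?_
    by_contra ha
    exact hCM (containsCMSubfieldOver_of_relation a ha hsum hrel)
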